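/- Let $(Z_t)_{t\ge 1}$ be i.i.d. real-valued random variables on a probability space, let $k\ge 0$ be an integer, and suppose that $\mathbb E|Z_1|^{2k+\gamma}<\infty$ for some $\gamma>0$. Let $\delta>0$ and $w(u)=(\log(e+|u|))^{-1/2-\delta}$ for $u\in\mathbb R$. For $n\ge 1$ let $$C_n(u)=n^{-1/2}\sum_{t=1}^n\left(e^{iuZ_t}-\mathbb E[e^{iuZ_1}]\right),\qquad u\in\mathbb R,$$ be the normalized empirical characteristic function process. Then for every $n\ge1$ and every sample point the function $C_n$ is $k$ times continuously differentiable on $\mathbb R$, with $k$-th derivative denoted by $C_n^{(k)}$ (and $C_n^{(0)}=C_n$), the weighted supremum $\sup_{u\in\mathbb R}|C_n^{(k)}(u)|\,w(u)$ is a random variable with values in $[0,\infty]$, and $$\sup_{n\ge 1}\ \mathbb E\left[\,\sup_{u\in\mathbb R}\left\{|C_n^{(k)}(u)|\,w(u)\right\}\right]<\infty .$$ -/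

import Mathlib

open MeasureTheory ProbabilityTheory
open scoped ENNReal

noncomputable section

/-- The normalized empirical characteristic function process
`C_n(u) = n^{-1/2} ∑_{t=1}^n (e^{iuZ_t} - E[e^{iuZ_1}])`, at the sample point `ω`.
The sequence is indexed from `0`, so `Z t` plays the role of `Z_{t+1}`. -/
def ecfProcess {Ω : Type*} [MeasurableSpace Ω] (μ : Measure Ω) (Z : ℕ → Ω → ℝ)
    (n : ℕ) (ω : Ω) (u : ℝ) : ℂ :=
  (((n : ℝ) ^ (-(1 / 2) : ℝ) : ℝ) : ℂ) *
    ∑ t ∈ Finset.range n,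
      (Complex.exp (Complex.I * (u : ℂ) * (Z t ω : ℂ)) -
        ∫ ω', Complex.exp (Complex.I * (u : ℂ) * (Z 0 ω' : ℂ)) ∂μ)

/-- The weight function `w(u) = (log(e + |u|))^{-1/2-δ}`. -/
def logWeight (δ : ℝ) (u : ℝ) : ℝ :=
  (Real.log (Real.exp 1 + |u|)) ^ (-(1 / 2) - δ : ℝ)

/-- The weighted supremum norm `‖f‖_{L_∞(w)} = sup_{u ∈ ℝ} |f(u)| w(u)`, with values in `[0, ∞]`. -/
def weightedSupNorm (w : ℝ → ℝ) (f : ℝ → ℂ) : ℝ≥0∞ :=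
  ⨆ u : ℝ, ENNReal.ofReal (‖f u‖ * w u)

end

open MeasureTheory ProbabilityTheory
open scoped ENNReal

/-! Conditionally on the data, the symmetrised process is at each point a Rademacher sum, hence
sub-Gaussian. Over the dyadic points of the line such sums grow only like the square root of the
logarithm of the index, and the weight absorbs this growth at infinity.

Symmetrisation, by an independent copy and then by exchanging the members of each pair, replaces
`C_n^(k)` by signed sums of kernel differences. One variable `K`, whose mean over the signs is
bounded by an absolute constant, controls all values at integers and all increments between
neighbouring dyadic points (`exists_signed_sum_bound`): a union bound suffices because `exp (-c²)`
is summable for the logarithmic factors `c`. The kernel is `α`-Hölder in `u` with constant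
`2|z|^(k+α)`, square integrable when `2α ≤ γ`, so increments at level `m` have conditional standard
deviation of order `2^(-αm)`. Chaining along the binary expansion of `u`
(`norm_le_of_dyadic_increments`) then bounds the process by `K A D √log(e+|u|)` on the whole line at
once. Here `D` is a convergent series and `A` is affine in the empirical moment of order `2k+γ`, so
its mean does not depend on `n`. -/

/-! ### Exponential moments and a maximal inequality for Rademacher sums -/

/-- The sign `±1` encoded by a Boolean. -/
def boolSign (b : Bool) : ℝ := cond b 1 (-1)

/-- The Laplace transform of a Rademacher sum is at most that of a Gaussian of the same variance. -/
theorem sum_exp_signed_sum_le {n : ℕ} (a : Fin n → ℝ) (l : ℝ) :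
    ∑ ε : Fin n → Bool, Real.exp (l * ∑ t, boolSign (ε t) * a t) ≤
      2 ^ n * Real.exp (l ^ 2 / 2 * ∑ t, a t ^ 2) := by
  have h1 : ∑ ε : Fin n → Bool, Real.exp (l * ∑ t, boolSign (ε t) * a t) =
      ∏ t, (2 * Real.cosh (l * a t)) := by
    have h2 : ∀ t, 2 * Real.cosh (l * a t) =
        ∑ b ∈ (Finset.univ : Finset Bool), Real.exp (l * (boolSign b * a t)) := by
      intro t
      rw [Real.cosh_eq]
      simp [boolSign]
      ring
    simp_rw [h2]
    rw [Finset.prod_univ_sum, Fintype.piFinset_univ]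
    refine Finset.sum_congr rfl fun ε _ => ?_
    rw [Finset.mul_sum, Real.exp_sum]
  rw [h1, Finset.prod_mul_distrib, Finset.mul_sum, Real.exp_sum]
  simp only [Finset.prod_const, Finset.card_univ, Fintype.card_fin]
  gcongr with t
  refine (Real.cosh_le_exp_half_sq _).trans (le_of_eq ?_)
  ring_nf

/-- Exponential moments of the modulus of a complex Rademacher sum. -/
theorem sum_exp_norm_signed_sum_le {n : ℕ} (a : Fin n → ℂ) (ha : ∑ t, ‖a t‖ ^ 2 ≤ 1)
    {c : ℝ} (hc : 0 ≤ c) :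
    ∑ ε : Fin n → Bool, Real.exp (c * ‖∑ t, (boolSign (ε t) : ℂ) * a t‖) ≤
      2 ^ n * (2 * Real.exp (2 * c ^ 2)) := by
  -- Used for real and imaginary parts with `l = ±2c`, whence the exponent `l²/2 = 2c²`.
  have key : ∀ b : Fin n → ℝ, (∀ t, b t ^ 2 ≤ ‖a t‖ ^ 2) → ∀ l : ℝ, l ^ 2 = 4 * c ^ 2 →
      ∑ ε : Fin n → Bool, Real.exp (l * ∑ t, boolSign (ε t) * b t) ≤
        2 ^ n * Real.exp (2 * c ^ 2) := by
    intro b hb l hl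
    refine (sum_exp_signed_sum_le b l).trans ?_
    have : ∑ t, b t ^ 2 ≤ 1 := (Finset.sum_le_sum fun t _ => hb t).trans ha
    refine mul_le_mul_of_nonneg_left (Real.exp_le_exp.2 ?_) (by positivity)
    rw [hl]
    nlinarith [sq_nonneg c]
  have hre := key (fun t => (a t).re) fun t => by
    simpa using pow_le_pow_left₀ (abs_nonneg _) (Complex.abs_re_le_norm (a t)) 2
  have him := key (fun t => (a t).im) fun t => by
    simpa using pow_le_pow_left₀ (abs_nonneg _) (Complex.abs_im_le_norm (a t)) 2
  have h1 := hre (2 * c) (by ring)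
  have h2 := hre (-(2 * c)) (by ring)
  have h3 := him (2 * c) (by ring)
  have h4 := him (-(2 * c)) (by ring)
  -- `exp (c‖z‖)` is at most `exp (c|Re z|) * exp (c|Im z|)`; AM-GM separates the factors at the
  -- price of doubling `c`.
  have pt : ∀ ε : Fin n → Bool, Real.exp (c * ‖∑ t, (boolSign (ε t) : ℂ) * a t‖) ≤
      (Real.exp (2 * c * ∑ t, boolSign (ε t) * (a t).re) +
       Real.exp (-(2 * c) * ∑ t, boolSign (ε t) * (a t).re) +
       Real.exp (2 * c * ∑ t, boolSign (ε t) * (a t).im) +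
       Real.exp (-(2 * c) * ∑ t, boolSign (ε t) * (a t).im)) / 2 := by
    intro ε
    have e1 : (∑ t, (boolSign (ε t) : ℂ) * a t).re = ∑ t, boolSign (ε t) * (a t).re := by
      simp [Complex.re_sum]
    have e2 : (∑ t, (boolSign (ε t) : ℂ) * a t).im = ∑ t, boolSign (ε t) * (a t).im := by
      simp [Complex.im_sum]
    rw [← e1, ← e2]
    set z := ∑ t, (boolSign (ε t) : ℂ) * a t
    have hz : c * ‖z‖ ≤ c * |z.re| + c * |z.im| := by
      nlinarith [Complex.norm_le_abs_re_add_abs_im z]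
    have habs : ∀ y : ℝ, Real.exp (2 * (c * |y|)) ≤
        Real.exp (2 * c * y) + Real.exp (-(2 * c) * y) := by
      intro y
      rcases abs_cases y with ⟨h, _⟩ | ⟨h, _⟩ <;> rw [h]
      · rw [show 2 * (c * y) = 2 * c * y by ring]
        linarith [Real.exp_pos (-(2 * c) * y)]
      · rw [show 2 * (c * -y) = -(2 * c) * y by ring]
        linarith [Real.exp_pos (2 * c * y)]
    have hsq : ∀ x y : ℝ, Real.exp (x + y) ≤ (Real.exp (2 * x) + Real.exp (2 * y)) / 2 := by
      intro x y
      rw [two_mul, two_mul, Real.exp_add, Real.exp_add, Real.exp_add]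
      nlinarith [sq_nonneg (Real.exp x - Real.exp y)]
    have := Real.exp_le_exp.2 hz
    linarith [hsq (c * |z.re|) (c * |z.im|), habs z.re, habs z.im]
  refine (Finset.sum_le_sum fun ε _ => pt ε).trans ?_
  rw [← Finset.sum_div, Finset.sum_add_distrib, Finset.sum_add_distrib, Finset.sum_add_distrib]
  linarith

/-- A maximal inequality for a family of complex Rademacher sums: normalised by their standard
deviations `σ i` and by the factors `c i`, they are dominated by a variable with bounded mean. -/
theorem exists_signed_sum_bound {ι : Type*} {n : ℕ} (a : ι → Fin n → ℂ) (σ c : ι → ℝ)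
    (hσ : ∀ i, 0 < σ i) (hc : ∀ i, 1 ≤ c i) (ha : ∀ i, ∑ t, ‖a i t‖ ^ 2 ≤ σ i ^ 2)
    (hsum : Summable fun i => Real.exp (-(c i) ^ 2)) :
    ∃ K : (Fin n → Bool) → ℝ, (∀ ε, 0 ≤ K ε) ∧
      (∀ ε i, ‖∑ t, (boolSign (ε t) : ℂ) * a i t‖ ≤ K ε * (σ i * c i)) ∧
      ∑ ε, K ε ≤ 2 ^ n * (3 + 2 * ∑' i, Real.exp (-(c i) ^ 2)) := by
  set x : (Fin n → Bool) → ι → ℝ := fun ε i => ‖∑ t, (boolSign (ε t) : ℂ) * a i t‖ / σ i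
  -- The exponential moment at `c` costs `2 exp (2c²)`; subtracting `3c²` leaves the summable `2 exp
  -- (-c²)`.
  set q : (Fin n → Bool) → ι → ℝ := fun ε i => Real.exp (c i * x ε i - 3 * c i ^ 2)
  have hq : ∀ i, ∑ ε, q ε i ≤ 2 ^ n * 2 * Real.exp (-(c i) ^ 2) := by
    intro i
    have h := sum_exp_norm_signed_sum_le (fun t => a i t / (σ i : ℂ)) (c := c i) (by
        simp only [norm_div, div_pow, Complex.norm_real, Real.norm_eq_abs, sq_abs]
        rw [← Finset.sum_div, div_le_one (pow_pos (hσ i) 2)]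
        exact ha i) (by linarith [hc i])
    have e : ∀ ε : Fin n → Bool, q ε i = Real.exp (-3 * c i ^ 2) *
        Real.exp (c i * ‖∑ t, (boolSign (ε t) : ℂ) * (a i t / (σ i : ℂ))‖) := by
      intro ε
      simp only [q, x]
      rw [← Real.exp_add]
      simp_rw [← mul_div_assoc]
      rw [← Finset.sum_div, norm_div, Complex.norm_real, Real.norm_of_nonneg (hσ i).le]
      ring_nf
    simp_rw [e]
    rw [← Finset.mul_sum]
    calc _ ≤ Real.exp (-3 * c i ^ 2) * (2 ^ n * (2 * Real.exp (2 * c i ^ 2))) := by gcongr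
      _ = 2 ^ n * 2 * (Real.exp (-3 * c i ^ 2) * Real.exp (2 * c i ^ 2)) := by ring
      _ = _ := by rw [← Real.exp_add]; ring_nf
  have hsq : ∀ ε, Summable (q ε) := fun ε =>
    Summable.of_nonneg_of_le (fun i => (Real.exp_pos _).le)
      (fun i => (Finset.single_le_sum (f := fun ε => q ε i)
        (fun ε _ => (Real.exp_pos _).le) (Finset.mem_univ ε)).trans (hq i)) (hsum.mul_left _)
  -- From `y ≤ exp y`, `c x - 3c² ≤ q`, so `x ≤ 3c + q/c ≤ (3 + q) c` because `c ≥ 1`.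
  refine ⟨fun ε => 3 + ∑' i, q ε i, fun ε => ?_, fun ε i => ?_, ?_⟩
  · have : 0 ≤ ∑' i, q ε i := tsum_nonneg fun i => (Real.exp_pos _).le
    linarith
  · have h1 : q ε i ≤ ∑' i, q ε i := (hsq ε).le_tsum i fun j _ => (Real.exp_pos _).le
    have hc0 : 0 < c i := by linarith [hc i]
    have h2 : x ε i ≤ (3 + q ε i) * c i := by
      have h3 : c i * x ε i - 3 * c i ^ 2 ≤ q ε i := by
        linarith [Real.add_one_le_exp (c i * x ε i - 3 * c i ^ 2)]
      have h4 : 0 ≤ q ε i := (Real.exp_pos _).le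
      have h5 : c i * x ε i ≤ c i * ((3 + q ε i) * c i) := by
        nlinarith [mul_nonneg h4 (sub_nonneg.2 (one_le_pow₀ (n := 2) (hc i)))]
      exact le_of_mul_le_mul_left h5 hc0
    have h6 : ‖∑ t, (boolSign (ε t) : ℂ) * a i t‖ = x ε i * σ i := by
      simp only [x]
      rw [div_mul_cancel₀ _ (hσ i).ne']
    rw [h6]
    calc x ε i * σ i ≤ ((3 + ∑' i, q ε i) * c i) * σ i := by
          have := (hσ i).le
          gcongr
          exact h2.trans (by gcongr)
      _ = _ := by ring
  · rw [Finset.sum_add_distrib, ← Summable.tsum_finsetSum fun ε _ => hsq ε]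
    have : ∑' i, ∑ ε, q ε i ≤ ∑' i, 2 ^ n * 2 * Real.exp (-(c i) ^ 2) :=
      Summable.tsum_le_tsum hq (summable_sum fun ε _ => hsq ε) (hsum.mul_left _)
    rw [tsum_mul_left] at this
    simp only [Finset.sum_const, Finset.card_univ, Fintype.card_fun, Fintype.card_bool,
      Fintype.card_fin, nsmul_eq_mul]
    push_cast
    linarith

/-! ### Logarithmic factors and dyadic chaining -/

/-- The logarithmic factor attached to the dyadic point `j / 2 ^ m`. -/
noncomputable def dyadicFactor (i : ℕ × ℤ) : ℝ :=
  Real.sqrt (1 + 2 * Real.log (i.1 + 1) + 2 * Real.log (1 + |(i.2 : ℝ)|))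

theorem dyadicFactor_sq (i : ℕ × ℤ) :
    dyadicFactor i ^ 2 = 1 + 2 * Real.log (i.1 + 1) + 2 * Real.log (1 + |(i.2 : ℝ)|) := by
  have h1 : 0 ≤ Real.log ((i.1 : ℝ) + 1) := Real.log_nonneg (by simp)
  have h2 : 0 ≤ Real.log (1 + |(i.2 : ℝ)|) := Real.log_nonneg (by simp)
  exact Real.sq_sqrt (by linarith)

theorem one_le_dyadicFactor (i : ℕ × ℤ) : 1 ≤ dyadicFactor i := by
  have h1 : 0 ≤ Real.log ((i.1 : ℝ) + 1) := Real.log_nonneg (by simp)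
  have h2 : 0 ≤ Real.log (1 + |(i.2 : ℝ)|) := Real.log_nonneg (by simp)
  exact Real.one_le_sqrt.2 (by linarith)

/-- The factor is chosen so that `exp (-c²)` equals `e⁻¹ (m+1)⁻² (1+|j|)⁻²`, a product of two
summable sequences. -/
theorem summable_exp_neg_dyadicFactor_sq :
    Summable fun i : ℕ × ℤ => Real.exp (-(dyadicFactor i) ^ 2) := by
  have hN : Summable fun m : ℕ => (((m : ℝ) + 1) ^ 2)⁻¹ := by
    have := (summable_nat_add_iff 1).2 (Real.summable_nat_pow_inv.2 (one_lt_two))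
    simpa using this
  have hZ : Summable fun j : ℤ => ((1 + |(j : ℝ)|) ^ 2)⁻¹ := by
    refine Summable.of_nat_of_neg ?_ ?_
    · simpa [add_comm] using hN
    · simpa [add_comm] using hN
  refine ((hN.mul_of_nonneg hZ (fun m => by positivity) (fun j => by positivity)).mul_left
    (Real.exp (-1))).congr fun i => ?_
  rw [dyadicFactor_sq, show -(1 + 2 * Real.log ((i.1 : ℝ) + 1) + 2 * Real.log (1 + |(i.2 : ℝ)|)) =
    -1 + (-(2 * Real.log ((i.1 : ℝ) + 1)) + -(2 * Real.log (1 + |(i.2 : ℝ)|))) by ring,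
    Real.exp_add, Real.exp_add, Real.exp_neg (2 * _), Real.exp_neg (2 * _)]
  have h : ∀ y : ℝ, 0 < y → Real.exp (2 * Real.log y) = y ^ 2 := fun y hy => by
    rw [two_mul, Real.exp_add, Real.exp_log hy, sq]
  rw [h _ (by positivity), h _ (by positivity)]

theorem one_le_log_exp_one_add_abs (u : ℝ) : 1 ≤ Real.log (Real.exp 1 + |u|) := by
  rw [Real.le_log_iff_exp_le (by positivity)]
  linarith [abs_nonneg u]

/-- The logarithm of the index is at most `m + log (e+|u|)`. The level thus costs only a factor
linear in `m`, which the geometric decay of increments absorbs. -/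
theorem dyadicFactor_le {m : ℕ} {j : ℤ} {u : ℝ} (h : 1 + |(j : ℝ)| ≤ 2 ^ m * (|u| + 2)) :
    dyadicFactor (m, j) ≤ 2 * (m + 1) * Real.sqrt (Real.log (Real.exp 1 + |u|)) := by
  set l := Real.log (Real.exp 1 + |u|) with hl
  have hl1 : 1 ≤ l := one_le_log_exp_one_add_abs u
  have h1 : Real.log ((m : ℝ) + 1) ≤ m := by
    have := Real.log_le_sub_one_of_pos (show (0 : ℝ) < m + 1 by positivity)
    linarith
  have h2 : Real.log (1 + |(j : ℝ)|) ≤ m + l := by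
    calc Real.log (1 + |(j : ℝ)|) ≤ Real.log (2 ^ m * (|u| + 2)) :=
          Real.log_le_log (by positivity) h
      _ = m * Real.log 2 + Real.log (|u| + 2) := by
          rw [Real.log_mul (by positivity) (by positivity), Real.log_pow]
      _ ≤ m * 1 + l := by
          gcongr
          · linarith [Real.log_two_lt_d9]
          · exact Real.log_le_log (by positivity) (by linarith [Real.add_one_le_exp (1 : ℝ)])
      _ = _ := by ring
  have hm : (0 : ℝ) ≤ m := by positivity
  rw [dyadicFactor, Real.sqrt_le_left (by positivity), mul_pow, Real.sq_sqrt (by linarith)]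
  simp only
  nlinarith [mul_nonneg hm (sub_nonneg.2 hl1), mul_nonneg (mul_nonneg hm hm) (by linarith : 0 ≤ l)]

/-- Dyadic chaining: a continuous function on the line is controlled by its values at the integers
and its increments between neighbouring dyadic points. -/
theorem norm_le_of_dyadic_increments {E : Type*} [NormedAddCommGroup E] {g : ℝ → E}
    (hg : Continuous g) {r B : ℝ} (hr : 0 ≤ r) (hr1 : r < 1) (hB : 0 ≤ B)
    (h0 : ∀ j : ℤ, ‖g j‖ ≤ B * dyadicFactor (0, j))
    (h1 : ∀ (m : ℕ) (j : ℤ), ‖g ((2 * j + 1) / 2 ^ (m + 1)) - g (j / 2 ^ m)‖ ≤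
      B * (r ^ (m + 1) * dyadicFactor (m + 1, j))) (u : ℝ) :
    ‖g u‖ ≤ B * (∑' m : ℕ, r ^ m * (2 * (m + 1))) *
      Real.sqrt (Real.log (Real.exp 1 + |u|)) := by
  set s := Real.sqrt (Real.log (Real.exp 1 + |u|)) with hs
  have hs0 : 0 ≤ s := Real.sqrt_nonneg _
  have hsum : Summable fun m : ℕ => r ^ m * (2 * ((m : ℝ) + 1)) := by
    have a1 := summable_pow_mul_geometric_of_norm_lt_one 1
      (show ‖r‖ < 1 by rwa [Real.norm_of_nonneg hr])
    have a2 := summable_geometric_of_lt_one hr hr1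
    refine ((a1.add a2).mul_left 2).congr fun m => ?_
    ring
  set v : ℕ → ℝ := fun m => (⌊2 ^ m * u⌋ : ℝ) / 2 ^ m with hv
  have hfl : ∀ m : ℕ, 1 + |(⌊2 ^ m * u⌋ : ℝ)| ≤ 2 ^ m * (|u| + 2) := by
    intro m
    have hp : (1 : ℝ) ≤ 2 ^ m := one_le_pow₀ (by norm_num)
    have b1 : |(⌊2 ^ m * u⌋ : ℝ) - 2 ^ m * u| ≤ 1 := by
      rw [abs_le]
      constructor <;> linarith [Int.floor_le (2 ^ m * u), Int.lt_floor_add_one (2 ^ m * u)]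
    have b2 : |(2 : ℝ) ^ m * u| = 2 ^ m * |u| := by rw [abs_mul, abs_of_nonneg (by positivity)]
    have b3 := abs_sub_abs_le_abs_sub (⌊2 ^ m * u⌋ : ℝ) (2 ^ m * u)
    linarith
  have hv_lim : Filter.Tendsto v Filter.atTop (nhds u) := by
    have hz : Filter.Tendsto (fun m : ℕ => ((1 : ℝ) / 2) ^ m) Filter.atTop (nhds 0) :=
      tendsto_pow_atTop_nhds_zero_of_lt_one (by norm_num) (by norm_num)
    rw [tendsto_iff_norm_sub_tendsto_zero]
    refine squeeze_zero (fun m => norm_nonneg _) (fun m => ?_) hz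
    have hp : (0 : ℝ) < 2 ^ m := by positivity
    have e : v m - u = ((⌊2 ^ m * u⌋ : ℝ) - 2 ^ m * u) / 2 ^ m := by
      simp only [hv]
      field_simp
    rw [e, norm_div, Real.norm_eq_abs, Real.norm_of_nonneg hp.le, one_div, inv_pow,
      div_eq_mul_inv]
    refine mul_le_of_le_one_left (by positivity) ?_
    rw [abs_le]
    constructor <;> linarith [Int.floor_le (2 ^ m * u), Int.lt_floor_add_one (2 ^ m * u)]
  have hstep : ∀ m : ℕ, ‖g (v (m + 1)) - g (v m)‖ ≤
      B * s * (r ^ (m + 1) * (2 * (((m + 1 : ℕ) : ℝ) + 1))) := by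
    intro m
    have hfac : dyadicFactor (m + 1, ⌊2 ^ m * u⌋) ≤ 2 * (((m + 1 : ℕ) : ℝ) + 1) * s := by
      refine dyadicFactor_le ((hfl m).trans ?_)
      have : (2 : ℝ) ^ m ≤ 2 ^ (m + 1) := pow_le_pow_right₀ (by norm_num) (by simp)
      gcongr
    -- The next binary digit of `u` is 0, and the approximation does not move, or 1, and it moves to
    -- the midpoint on the right. Hence only the increments in `h1` matter, indexed by their left
    -- endpoint `j / 2 ^ m`.
    have hcase : ⌊2 ^ (m + 1) * u⌋ = 2 * ⌊2 ^ m * u⌋ ∨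
        ⌊2 ^ (m + 1) * u⌋ = 2 * ⌊2 ^ m * u⌋ + 1 := by
      have e : (2 : ℝ) ^ (m + 1) * u = 2 * (2 ^ m * u) := by ring
      have c1 := Int.floor_le (2 ^ m * u)
      have c2 := Int.lt_floor_add_one (2 ^ m * u)
      have c3 : 2 * ⌊2 ^ m * u⌋ ≤ ⌊2 ^ (m + 1) * u⌋ := by
        rw [Int.le_floor]; push_cast; linarith
      have c4 : ⌊2 ^ (m + 1) * u⌋ < 2 * ⌊2 ^ m * u⌋ + 2 := by
        rw [Int.floor_lt]; push_cast; linarith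
      omega
    rcases hcase with h | h
    · have : v (m + 1) = v m := by
        simp only [hv, h]
        push_cast
        rw [pow_succ]
        field_simp
      rw [this, sub_self, norm_zero]
      positivity
    · have : v (m + 1) = (2 * (⌊2 ^ m * u⌋ : ℝ) + 1) / 2 ^ (m + 1) := by
        simp only [hv, h]
        push_cast
        rfl
      rw [this]
      refine (h1 m _).trans ?_
      calc _ ≤ B * (r ^ (m + 1) * (2 * (((m + 1 : ℕ) : ℝ) + 1) * s)) := by gcongr
        _ = _ := by ring
  have hpart : ∀ M : ℕ, ‖g (v M)‖ ≤
      B * s * ∑ m ∈ Finset.range (M + 1), r ^ m * (2 * ((m : ℝ) + 1)) := by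
    intro M
    induction M with
    | zero =>
      have e : v 0 = (⌊u⌋ : ℝ) := by simp [hv]
      have f : dyadicFactor (0, ⌊u⌋) ≤ 2 * (((0 : ℕ) : ℝ) + 1) * s :=
        dyadicFactor_le (by simpa using hfl 0)
      rw [e]
      refine (h0 _).trans ?_
      calc _ ≤ B * (2 * (((0 : ℕ) : ℝ) + 1) * s) := by gcongr
        _ = _ := by simp; ring
    | succ M ih =>
      rw [Finset.sum_range_succ, mul_add]
      have := norm_add_le (g (v M)) (g (v (M + 1)) - g (v M))
      rw [add_sub_cancel] at this
      linarith [hstep M]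
  refine le_of_tendsto ((hg.tendsto u).comp hv_lim).norm (Filter.Eventually.of_forall fun M => ?_)
  refine (hpart M).trans ?_
  rw [mul_right_comm]
  gcongr
  exact hsum.sum_le_tsum _ fun m _ => by positivity

/-! ### Kernel and weight estimates -/

/-- The `k`-th derivative in `u` of `exp (i u z)`. -/
noncomputable def ecfKernel (k : ℕ) (z u : ℝ) : ℂ :=
  (Complex.I * z) ^ k * Complex.exp (Complex.I * u * z)

theorem norm_cexp_I_mul (u z : ℝ) : ‖Complex.exp (Complex.I * u * z)‖ = 1 := by
  rw [mul_assoc, ← Complex.ofReal_mul, Complex.norm_exp_I_mul_ofReal]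

theorem norm_ecfKernel (k : ℕ) (z u : ℝ) : ‖ecfKernel k z u‖ = |z| ^ k := by
  rw [ecfKernel, norm_mul, norm_cexp_I_mul, norm_pow, norm_mul, Complex.norm_I,
    Complex.norm_real, one_mul, mul_one, Real.norm_eq_abs]

@[fun_prop]
theorem continuous_ecfKernel (k : ℕ) (z : ℝ) : Continuous (ecfKernel k z) := by
  unfold ecfKernel
  fun_prop

theorem measurable_ecfKernel (k : ℕ) (u : ℝ) : Measurable fun z => ecfKernel k z u := by
  unfold ecfKernel
  fun_prop

theorem rpow_le_one_add_rpow {x p q : ℝ} (hx : 0 ≤ x) (hp : 0 ≤ p) (hpq : p ≤ q) :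
    x ^ p ≤ 1 + x ^ q := by
  rcases le_total x 1 with h | h
  · linarith [Real.rpow_le_one hx h hp, Real.rpow_nonneg hx q]
  · linarith [Real.rpow_le_rpow_of_exponent_le h hpq]

/-- Interpolates between the Lipschitz bound `d` (for `d ≤ 1`) and the trivial bound `2` (for `d ≥
1`), so that only `α` extra powers of `|z|` are spent. -/
theorem norm_cexp_sub_cexp_le (u v z : ℝ) {α : ℝ} (hα : 0 < α) (hα1 : α ≤ 1) :
    ‖Complex.exp (Complex.I * u * z) - Complex.exp (Complex.I * v * z)‖ ≤
      2 * (|u - v| * |z|) ^ α := by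
  set d := |u - v| * |z| with hd
  have hd0 : 0 ≤ d := by positivity
  rcases le_total d 1 with h | h
  · have e : Complex.exp (Complex.I * u * z) - Complex.exp (Complex.I * v * z) =
        Complex.exp (Complex.I * v * z) *
          (Complex.exp (Complex.I * (((u - v) * z : ℝ) : ℂ)) - 1) := by
      rw [mul_sub, ← Complex.exp_add, mul_one]
      congr 2
      push_cast
      ring
    rw [e, norm_mul, norm_cexp_I_mul, one_mul]
    refine Real.norm_exp_I_mul_ofReal_sub_one_le.trans ?_
    rw [Real.norm_eq_abs, abs_mul, ← hd]
    have : d ^ (1 : ℝ) ≤ d ^ α := Real.rpow_le_rpow_of_exponent_ge' hd0 h hα.le hα1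
    rw [Real.rpow_one] at this
    linarith
  · refine (norm_sub_le _ _).trans ?_
    rw [norm_cexp_I_mul, norm_cexp_I_mul]
    linarith [Real.one_le_rpow h hα.le]

theorem norm_ecfKernel_sq_le (k : ℕ) (z u : ℝ) {γ : ℝ} (hγ : 0 < γ) :
    ‖ecfKernel k z u‖ ^ 2 ≤ 1 + |z| ^ (2 * (k : ℝ) + γ) := by
  rw [norm_ecfKernel, ← pow_mul, ← Real.rpow_natCast]
  refine rpow_le_one_add_rpow (abs_nonneg z) (by positivity) ?_
  push_cast
  linarith

theorem norm_ecfKernel_sub_sq_le (k : ℕ) (z u v : ℝ) {α γ : ℝ} (hα : 0 < α) (hα1 : α ≤ 1)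
    (hαγ : 2 * α ≤ γ) :
    ‖ecfKernel k z u - ecfKernel k z v‖ ^ 2 ≤
      4 * (|u - v| ^ α) ^ 2 * (1 + |z| ^ (2 * (k : ℝ) + γ)) := by
  have h1 : ‖ecfKernel k z u - ecfKernel k z v‖ ≤ |z| ^ k * (2 * (|u - v| * |z|) ^ α) := by
    rw [ecfKernel, ecfKernel, ← mul_sub, norm_mul, norm_pow, norm_mul, Complex.norm_I,
      Complex.norm_real, one_mul, Real.norm_eq_abs]
    gcongr
    exact norm_cexp_sub_cexp_le u v z hα hα1
  rw [Real.mul_rpow (abs_nonneg _) (abs_nonneg _)] at h1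
  have h2 : (|z| ^ k * |z| ^ α) ^ 2 = |z| ^ (2 * (k : ℝ) + 2 * α) := by
    rw [← Real.rpow_natCast |z| k, ← Real.rpow_add_of_nonneg (abs_nonneg z) (by positivity) hα.le,
      ← Real.rpow_natCast, ← Real.rpow_mul (abs_nonneg z)]
    push_cast
    ring_nf
  calc _ ≤ (|z| ^ k * (2 * (|u - v| ^ α * |z| ^ α))) ^ 2 := by gcongr
    _ = 4 * (|u - v| ^ α) ^ 2 * (|z| ^ k * |z| ^ α) ^ 2 := by ring
    _ ≤ _ := by
      rw [h2]
      gcongr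
      exact rpow_le_one_add_rpow (abs_nonneg z) (by positivity) (by linarith)

theorem logWeight_nonneg (δ u : ℝ) : 0 ≤ logWeight δ u :=
  Real.rpow_nonneg (by linarith [one_le_log_exp_one_add_abs u]) _

theorem continuous_logWeight (δ : ℝ) : Continuous (logWeight δ) := by
  have h : ∀ u : ℝ, Real.exp 1 + |u| ≠ 0 := fun u => by positivity
  refine Continuous.rpow_const ((by fun_prop : Continuous fun u : ℝ => Real.exp 1 + |u|).log h)
    fun u => Or.inl ?_
  linarith [one_le_log_exp_one_add_abs u]

theorem sqrt_log_mul_logWeight_le {δ : ℝ} (hδ : 0 ≤ δ) (u : ℝ) :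
    Real.sqrt (Real.log (Real.exp 1 + |u|)) * logWeight δ u ≤ 1 := by
  have h := one_le_log_exp_one_add_abs u
  rw [logWeight, Real.sqrt_eq_rpow, ← Real.rpow_add (by linarith)]
  exact Real.rpow_le_one_of_one_le_of_nonpos h (by linarith)

/-- The weighted supremum of a random continuous function is measurable. -/
theorem measurable_weightedSupNorm {X : Type*} [MeasurableSpace X] {w : ℝ → ℝ}
    (hw : Continuous w) {f : X → ℝ → ℂ} (hm : ∀ u, Measurable fun x => f x u)
    (hc : ∀ x, Continuous (f x)) : Measurable fun x => weightedSupNorm w (f x) := by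
  -- By continuity the supremum may be taken over the countable dense set of rationals.
  have e : ∀ x, weightedSupNorm w (f x) = ⨆ q : ℚ, ENNReal.ofReal (‖f x q‖ * w q) := by
    intro x
    have hcont : Continuous fun u => ENNReal.ofReal (‖f x u‖ * w u) :=
      ENNReal.continuous_ofReal.comp ((hc x).norm.mul hw)
    refine le_antisymm (iSup_le fun u => ?_) (iSup_le fun q => le_iSup_of_le (q : ℝ) le_rfl)
    have hcl : IsClosed {u | ENNReal.ofReal (‖f x u‖ * w u) ≤
        ⨆ q : ℚ, ENNReal.ofReal (‖f x q‖ * w q)} := isClosed_le hcont continuous_const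
    exact Rat.denseRange_cast.induction_on u hcl fun q => le_iSup_of_le q le_rfl
  simp_rw [e]
  refine Measurable.iSup fun q => ?_
  exact ((hm q).norm.mul_const _).ennreal_ofReal

/-! ### The bound conditional on the data -/

/-- Conditional bound for the symmetrised process: the average over all signs of the weighted
supremum is controlled by an empirical moment. -/
theorem exists_sum_signs_weightedSupNorm_le (k : ℕ) {γ : ℝ} (hγ : 0 < γ) :
    ∃ C : ℝ, 0 ≤ C ∧ ∀ (δ : ℝ), 0 ≤ δ → ∀ (n : ℕ), 1 ≤ n → ∀ (p : Fin n → ℝ × ℝ),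
      ∑ ε : Fin n → Bool, weightedSupNorm (logWeight δ) (fun u =>
        (((n : ℝ) ^ (-(1 / 2) : ℝ) : ℝ) : ℂ) * ∑ t, (boolSign (ε t) : ℂ) *
          (ecfKernel k (p t).1 u - ecfKernel k (p t).2 u)) ≤
      2 ^ n * ENNReal.ofReal (C * (1 + 8 / n * ∑ t, ((1 + |(p t).1| ^ (2 * (k : ℝ) + γ)) +
        (1 + |(p t).2| ^ (2 * (k : ℝ) + γ))))) := by
  obtain ⟨α, hα, hα1, hαγ⟩ : ∃ α : ℝ, 0 < α ∧ α ≤ 1 ∧ 2 * α ≤ γ :=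
    ⟨min (γ / 2) 1, lt_min (by linarith) one_pos, min_le_right _ _,
      by linarith [min_le_left (γ / 2) 1]⟩
  set r : ℝ := (1 / 2 : ℝ) ^ α with hr
  have hr0 : 0 < r := Real.rpow_pos_of_pos (by norm_num) _
  have hr1 : r < 1 := Real.rpow_lt_one (by norm_num) (by norm_num) hα
  set D : ℝ := ∑' m : ℕ, r ^ m * (2 * ((m : ℝ) + 1)) with hD
  have hD0 : 0 ≤ D := tsum_nonneg fun m => by positivity
  set T : ℝ := ∑' i : ℕ × ℤ, Real.exp (-(dyadicFactor i) ^ 2) with hT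
  have hT0 : 0 ≤ T := tsum_nonneg fun i => (Real.exp_pos _).le
  refine ⟨(3 + 2 * T) * D, by positivity, fun δ hδ n hn p => ?_⟩
  have hn0 : (0 : ℝ) < n := by exact_mod_cast hn
  set h : ℝ → ℝ := fun z => 1 + |z| ^ (2 * (k : ℝ) + γ) with hh
  have hh0 : ∀ z, 0 ≤ h z := fun z => by
    have := Real.rpow_nonneg (abs_nonneg z) (2 * (k : ℝ) + γ)
    simp only [hh]
    linarith
  -- `8` is the Hölder constant `4` times the `2` from `‖x - y‖² ≤ 2‖x‖² + 2‖y‖²`. The added `1`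
  -- gives `A - 1 ≤ A²`, so `A` itself serves as a standard deviation and remains linear in the
  -- empirical moment.
  set A : ℝ := 1 + 8 / n * ∑ t, (h (p t).1 + h (p t).2) with hA
  have hS0 : 0 ≤ ∑ t, (h (p t).1 + h (p t).2) :=
    Finset.sum_nonneg fun t _ => add_nonneg (hh0 _) (hh0 _)
  have hA1 : 1 ≤ A := by
    have : 0 ≤ 8 / (n : ℝ) * ∑ t, (h (p t).1 + h (p t).2) := by positivity
    linarith
  set s : ℂ := (((n : ℝ) ^ (-(1 / 2) : ℝ) : ℝ) : ℂ) with hs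
  have hs2 : ‖s‖ ^ 2 = 1 / n := by
    rw [hs, Complex.norm_real, Real.norm_of_nonneg (by positivity), ← Real.rpow_natCast,
      ← Real.rpow_mul hn0.le]
    norm_num [Real.rpow_neg_one]
  set d : Fin n → ℝ → ℂ := fun t u => ecfKernel k (p t).1 u - ecfKernel k (p t).2 u with hd
  -- Level `0` carries the values at integers; level `m + 1` the increments from `j / 2 ^ m` to the
  -- midpoint on its right.
  set a : ℕ × ℤ → Fin n → ℂ := fun i t => match i with
    | (0, j) => s * d t j
    | (m + 1, j) => s * (d t ((2 * j + 1) / 2 ^ (m + 1)) - d t (j / 2 ^ m)) with ha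
  have hpar : ∀ x y : ℂ, ‖x - y‖ ^ 2 ≤ 2 * ‖x‖ ^ 2 + 2 * ‖y‖ ^ 2 := fun x y => by
    have h1 : ‖x - y‖ ^ 2 ≤ (‖x‖ + ‖y‖) ^ 2 :=
      pow_le_pow_left₀ (norm_nonneg _) (norm_sub_le x y) 2
    nlinarith [sq_nonneg (‖x‖ - ‖y‖)]
  have hsumle : ∀ (b : Fin n → ℂ) (ρ : ℝ), 0 ≤ ρ →
      (∀ t, ‖b t‖ ^ 2 ≤ 8 * ρ ^ 2 * (h (p t).1 + h (p t).2)) →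
      ∑ t, ‖s * b t‖ ^ 2 ≤ (A * ρ) ^ 2 := by
    intro b ρ hρ hb
    simp_rw [norm_mul, mul_pow, hs2]
    rw [← Finset.mul_sum]
    have h1 : ∑ t, ‖b t‖ ^ 2 ≤ 8 * ρ ^ 2 * ∑ t, (h (p t).1 + h (p t).2) := by
      rw [Finset.mul_sum]
      exact Finset.sum_le_sum fun t _ => hb t
    calc 1 / (n : ℝ) * ∑ t, ‖b t‖ ^ 2
        ≤ 1 / (n : ℝ) * (8 * ρ ^ 2 * ∑ t, (h (p t).1 + h (p t).2)) := by gcongr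
      _ = (8 / n * ∑ t, (h (p t).1 + h (p t).2)) * ρ ^ 2 := by ring
      _ ≤ A ^ 2 * ρ ^ 2 := by
        gcongr
        nlinarith
  obtain ⟨K, hK0, hK, hKsum⟩ := exists_signed_sum_bound a (fun i => A * r ^ i.1) dyadicFactor
    (fun i => by positivity) one_le_dyadicFactor (by
      rintro ⟨m, j⟩
      cases m with
      | zero =>
        refine hsumle _ _ (by simp) fun t => ?_
        have h1 := norm_ecfKernel_sq_le k (p t).1 j hγ
        have h2 := norm_ecfKernel_sq_le k (p t).2 j hγ
        have h3 := hpar (ecfKernel k (p t).1 j) (ecfKernel k (p t).2 j)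
        have h4 := hh0 (p t).1
        have h5 := hh0 (p t).2
        simp only [pow_zero, one_pow, mul_one]
        simp only [hd, hh] at h4 h5 ⊢
        linarith
      | succ m =>
        refine hsumle _ _ (by positivity) fun t => ?_
        have e : |((2 * (j : ℝ) + 1) / 2 ^ (m + 1)) - j / 2 ^ m| ^ α = r ^ (m + 1) := by
          have : (2 * (j : ℝ) + 1) / 2 ^ (m + 1) - j / 2 ^ m = (1 / 2) ^ (m + 1) := by
            rw [pow_succ, one_div, inv_pow, pow_succ]
            field_simp
            ring
          rw [this, abs_of_nonneg (by positivity), hr, ← Real.rpow_natCast, ← Real.rpow_mul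
            (by norm_num), mul_comm, Real.rpow_mul (by norm_num), Real.rpow_natCast]
        have h1 := norm_ecfKernel_sub_sq_le k (p t).1 ((2 * (j : ℝ) + 1) / 2 ^ (m + 1))
          (j / 2 ^ m) hα hα1 hαγ
        have h2 := norm_ecfKernel_sub_sq_le k (p t).2 ((2 * (j : ℝ) + 1) / 2 ^ (m + 1))
          (j / 2 ^ m) hα hα1 hαγ
        rw [e] at h1 h2
        simp only [hd]
        rw [sub_sub_sub_comm]
        refine (hpar _ _).trans ?_
        simp only [hh]
        linarith) summable_exp_neg_dyadicFactor_sq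
  have hbound : ∀ ε : Fin n → Bool, weightedSupNorm (logWeight δ) (fun u =>
      s * ∑ t, (boolSign (ε t) : ℂ) * d t u) ≤ ENNReal.ofReal (K ε * (A * D)) := by
    intro ε
    have e : ∀ b : Fin n → ℂ, s * ∑ t, (boolSign (ε t) : ℂ) * b t =
        ∑ t, (boolSign (ε t) : ℂ) * (s * b t) := fun b => by
      rw [Finset.mul_sum]
      exact Finset.sum_congr rfl fun t _ => by ring
    refine iSup_le fun u => ENNReal.ofReal_le_ofReal ?_
    have hg := norm_le_of_dyadic_increments (g := fun u => s * ∑ t, (boolSign (ε t) : ℂ) * d t u)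
      (by simp only [hd]; fun_prop) hr0.le hr1 (B := K ε * A)
      (mul_nonneg (hK0 ε) (by linarith))
      (fun j => by
        simp only [e]
        refine (hK ε (0, j)).trans (le_of_eq ?_)
        simp
        ring)
      (fun m j => by
        rw [← mul_sub, ← Finset.sum_sub_distrib]
        simp_rw [← mul_sub]
        rw [e]
        refine (hK ε (m + 1, j)).trans (le_of_eq ?_)
        ring) u
    have hw := sqrt_log_mul_logWeight_le hδ u
    have hKA : 0 ≤ K ε * A * D := mul_nonneg (mul_nonneg (hK0 ε) (by linarith)) hD0
    calc _ ≤ K ε * A * D * Real.sqrt (Real.log (Real.exp 1 + |u|)) * logWeight δ u :=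
          mul_le_mul_of_nonneg_right hg (logWeight_nonneg δ u)
      _ = K ε * A * D * (Real.sqrt (Real.log (Real.exp 1 + |u|)) * logWeight δ u) := by ring
      _ ≤ K ε * A * D * 1 := by gcongr
      _ = _ := by ring
  have hAD : 0 ≤ A * D := by positivity
  refine (Finset.sum_le_sum fun ε _ => hbound ε).trans ?_
  rw [← ENNReal.ofReal_sum_of_nonneg fun ε _ => mul_nonneg (hK0 ε) hAD, ← Finset.sum_mul,
    show (2 : ℝ≥0∞) ^ n = ENNReal.ofReal (2 ^ n) by simp [ENNReal.ofReal_pow],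
    ← ENNReal.ofReal_mul (by positivity)]
  refine ENNReal.ofReal_le_ofReal ((mul_le_mul_of_nonneg_right hKsum hAD).trans (le_of_eq ?_))
  ring

theorem ofReal_norm_mul_eq {w : ℝ} (hw : 0 ≤ w) (x : ℂ) :
    ENNReal.ofReal (‖x‖ * w) = ‖(w : ℂ) * x‖ₑ := by
  rw [← ofReal_norm, norm_mul, Complex.norm_real, Real.norm_of_nonneg hw, mul_comm]

/-! ### Symmetrisation and the bound for the product law -/

/-- Symmetrisation by an independent copy. -/
theorem lintegral_weightedSupNorm_le_copy {X : Type*} [MeasurableSpace X] (ν : Measure X)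
    [IsProbabilityMeasure ν] {w : ℝ → ℝ} (hw : Continuous w) (hw0 : ∀ u, 0 ≤ w u)
    {F : X → ℝ → ℂ} (hm : ∀ u, Measurable fun x => F x u) (hc : ∀ x, Continuous (F x))
    (hi : ∀ u, Integrable (fun x => F x u) ν) (n : ℕ) (s : ℂ) :
    ∫⁻ z : Fin n → X, weightedSupNorm w (fun u => s * ∑ t, (F (z t) u - ∫ x, F x u ∂ν))
        ∂(Measure.pi fun _ => ν) ≤
      ∫⁻ p : Fin n → X × X, weightedSupNorm w (fun u => s * ∑ t, (F (p t).1 u - F (p t).2 u))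
        ∂(Measure.pi fun _ => ν.prod ν) := by
  set H : (Fin n → X) × (Fin n → X) → ℝ≥0∞ := fun q =>
    weightedSupNorm w (fun u => s * ∑ t, (F (q.1 t) u - F (q.2 t) u)) with hH
  have hHm : Measurable H := by
    refine measurable_weightedSupNorm hw (fun u => ?_) fun q => ?_
    · refine measurable_const.mul (Finset.measurable_sum _ fun t _ => ?_)
      exact ((hm u).comp ((measurable_pi_apply t).comp measurable_fst)).sub
        ((hm u).comp ((measurable_pi_apply t).comp measurable_snd))
    · exact continuous_const.mul (continuous_finsetSum _ fun t _ => (hc _).sub (hc _))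
  have e := (measurePreserving_arrowProdEquivProdArrow X X (Fin n) (fun _ => ν)
    (fun _ => ν)).lintegral_comp hHm
  have e' : ∫⁻ p : Fin n → X × X, weightedSupNorm w
      (fun u => s * ∑ t, (F (p t).1 u - F (p t).2 u)) ∂(Measure.pi fun _ => ν.prod ν) =
      ∫⁻ q, H q ∂((Measure.pi fun _ => ν).prod (Measure.pi fun _ => ν)) := e
  rw [e', lintegral_prod _ hHm.aemeasurable]
  refine lintegral_mono fun z => iSup_le fun u => ?_
  have hit : ∀ t : Fin n, Integrable (fun y : Fin n → X => F (y t) u)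
      (Measure.pi fun _ => ν) := fun t =>
    (measurePreserving_eval (fun _ : Fin n => ν) t).integrable_comp_of_integrable (hi u)
  have hit' : ∀ t : Fin n, Integrable (fun y : Fin n → X => F (z t) u - F (y t) u)
      (Measure.pi fun _ => ν) := fun t => (integrable_const _).sub (hit t)
  -- The centred sum is the average over the copy `y` of the uncentred difference; the supremum of
  -- an average is at most the average of the suprema.
  have hint : s * ∑ t, (F (z t) u - ∫ x, F x u ∂ν) =
      ∫ y : Fin n → X, s * ∑ t, (F (z t) u - F (y t) u) ∂(Measure.pi fun _ => ν) := by
    rw [integral_const_mul, integral_finsetSum _ fun t _ => hit' t]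
    congr 1
    refine Finset.sum_congr rfl fun t _ => ?_
    rw [integral_sub (integrable_const _) (hit t), integral_const,
      integral_comp_eval (μ := fun _ : Fin n => ν) (hi u).aestronglyMeasurable]
    simp
  simp only [ofReal_norm_mul_eq (hw0 u)]
  rw [hint, ← integral_const_mul]
  refine (enorm_integral_le_lintegral_enorm _).trans (lintegral_mono fun y => ?_)
  rw [← ofReal_norm_mul_eq (hw0 u)]
  exact le_iSup (fun u => ENNReal.ofReal (‖s * ∑ t, (F (z t) u - F (y t) u)‖ * w u)) u

/-- Symmetrisation by random signs. -/
theorem lintegral_weightedSupNorm_le_signs {X : Type*} [MeasurableSpace X] (ν : Measure X)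
    [IsProbabilityMeasure ν] {w : ℝ → ℝ} (hw : Continuous w) (hw0 : ∀ u, 0 ≤ w u)
    {F : X → ℝ → ℂ} (hm : ∀ u, Measurable fun x => F x u) (hc : ∀ x, Continuous (F x))
    (hi : ∀ u, Integrable (fun x => F x u) ν) (n : ℕ) (s : ℂ) :
    2 ^ n * ∫⁻ z : Fin n → X, weightedSupNorm w (fun u => s * ∑ t, (F (z t) u - ∫ x, F x u ∂ν))
        ∂(Measure.pi fun _ => ν) ≤
      ∫⁻ p : Fin n → X × X, ∑ ε : Fin n → Bool, weightedSupNorm w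
        (fun u => s * ∑ t, (boolSign (ε t) : ℂ) * (F (p t).1 u - F (p t).2 u))
        ∂(Measure.pi fun _ => ν.prod ν) := by
  set H : (Fin n → X × X) → ℝ≥0∞ := fun p =>
    weightedSupNorm w (fun u => s * ∑ t, (F (p t).1 u - F (p t).2 u)) with hH
  have hfst : ∀ (u : ℝ) (t : Fin n), Measurable fun p : Fin n → X × X => F (p t).1 u := fun u t =>
    (hm u).comp (measurable_fst.comp (measurable_pi_apply t))
  have hsnd : ∀ (u : ℝ) (t : Fin n), Measurable fun p : Fin n → X × X => F (p t).2 u := fun u t =>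
    (hm u).comp (measurable_snd.comp (measurable_pi_apply t))
  have hHm : Measurable H := by
    refine measurable_weightedSupNorm hw (fun u => ?_) fun p => ?_
    · exact measurable_const.mul (Finset.measurable_sum _ fun t _ => (hfst u t).sub (hsnd u t))
    · exact continuous_const.mul (continuous_finsetSum _ fun t _ => (hc _).sub (hc _))
  have hterm : ∀ ε : Fin n → Bool, ∫⁻ p : Fin n → X × X, weightedSupNorm w
        (fun u => s * ∑ t, (boolSign (ε t) : ℂ) * (F (p t).1 u - F (p t).2 u))
        ∂(Measure.pi fun _ => ν.prod ν) = ∫⁻ p, H p ∂(Measure.pi fun _ => ν.prod ν) := by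
    intro ε
    -- A sign `-1` amounts to swapping the two members of a pair, which preserves `ν.prod ν`. Each
    -- sign pattern therefore has the same integral.
    have hmp : MeasurePreserving
        (fun (p : Fin n → X × X) t => (cond (ε t) id Prod.swap : X × X → X × X) (p t))
        (Measure.pi fun _ => ν.prod ν) (Measure.pi fun _ => ν.prod ν) := by
      refine measurePreserving_pi (fun _ => ν.prod ν) (fun _ => ν.prod ν) fun t => ?_
      cases ε t
      · exact Measure.measurePreserving_swap
      · exact MeasurePreserving.id _
    rw [← hmp.lintegral_comp hHm]
    refine lintegral_congr fun p => ?_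
    simp only [hH]
    congr 1
    ext u
    congr 1
    refine Finset.sum_congr rfl fun t _ => ?_
    cases ε t <;> simp [boolSign]
  rw [lintegral_finsetSum]
  · simp_rw [hterm]
    rw [Finset.sum_const, Finset.card_univ, Fintype.card_fun, Fintype.card_bool,
      Fintype.card_fin, nsmul_eq_mul]
    push_cast
    gcongr
    exact lintegral_weightedSupNorm_le_copy ν hw hw0 hm hc hi n s
  · intro ε _
    refine measurable_weightedSupNorm hw (fun u => ?_) fun p => ?_
    · exact measurable_const.mul (Finset.measurable_sum _ fun t _ =>
        measurable_const.mul ((hfst u t).sub (hsnd u t)))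
    · exact continuous_const.mul (continuous_finsetSum _ fun t _ =>
        continuous_const.mul ((hc _).sub (hc _)))

/-- The uniform bound for the weighted empirical process of the kernels, for a sample with the
product law. -/
theorem exists_lintegral_weightedSupNorm_ecfKernel_le (ν : Measure ℝ) [IsProbabilityMeasure ν]
    (k : ℕ) {γ : ℝ} (hγ : 0 < γ) (hν : Integrable (fun z => |z| ^ (2 * (k : ℝ) + γ)) ν)
    (hi : ∀ u, Integrable (fun z => ecfKernel k z u) ν) {δ : ℝ} (hδ : 0 ≤ δ) :
    ∃ M : ℝ≥0∞, M < ⊤ ∧ ∀ n : ℕ, 1 ≤ n →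
      ∫⁻ z : Fin n → ℝ, weightedSupNorm (logWeight δ) (fun u =>
        (((n : ℝ) ^ (-(1 / 2) : ℝ) : ℝ) : ℂ) *
          ∑ t, (ecfKernel k (z t) u - ∫ x, ecfKernel k x u ∂ν)) ∂(Measure.pi fun _ => ν) ≤ M := by
  obtain ⟨C, hC0, hC⟩ := exists_sum_signs_weightedSupNorm_le k hγ
  set h : ℝ → ℝ := fun z => 1 + |z| ^ (2 * (k : ℝ) + γ) with hh
  have hhm : Measurable h := by fun_prop
  have hhi : Integrable h ν := (integrable_const 1).add hν
  have hh0 : ∀ z, 0 ≤ h z := fun z => by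
    have := Real.rpow_nonneg (abs_nonneg z) (2 * (k : ℝ) + γ)
    simp only [hh]
    linarith
  -- `16 = 8 * 2`: each of the two members of a pair contributes `∫ h`, and the sum over `t` cancels
  -- `1 / n`.
  refine ⟨ENNReal.ofReal (C * (1 + 16 * ∫ z, h z ∂ν)), ENNReal.ofReal_lt_top, fun n hn => ?_⟩
  have hn0 : (n : ℝ) ≠ 0 := by exact_mod_cast (by omega : n ≠ 0)
  have hmp1 : ∀ t : Fin n, MeasurePreserving (fun p : Fin n → ℝ × ℝ => (p t).1)
      (Measure.pi fun _ => ν.prod ν) ν := fun t =>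
    measurePreserving_fst.comp (measurePreserving_eval (fun _ : Fin n => ν.prod ν) t)
  have hmp2 : ∀ t : Fin n, MeasurePreserving (fun p : Fin n → ℝ × ℝ => (p t).2)
      (Measure.pi fun _ => ν.prod ν) ν := fun t =>
    measurePreserving_snd.comp (measurePreserving_eval (fun _ : Fin n => ν.prod ν) t)
  have hi1 : ∀ t : Fin n, Integrable (fun p : Fin n → ℝ × ℝ => h (p t).1)
      (Measure.pi fun _ => ν.prod ν) := fun t => (hmp1 t).integrable_comp_of_integrable hhi
  have hi2 : ∀ t : Fin n, Integrable (fun p : Fin n → ℝ × ℝ => h (p t).2)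
      (Measure.pi fun _ => ν.prod ν) := fun t => (hmp2 t).integrable_comp_of_integrable hhi
  have he1 : ∀ t : Fin n, ∫ p : Fin n → ℝ × ℝ, h (p t).1 ∂(Measure.pi fun _ => ν.prod ν) =
      ∫ z, h z ∂ν := fun t => by
    have := integral_map (hmp1 t).measurable.aemeasurable
      (hhm.aestronglyMeasurable (μ := Measure.map _ (Measure.pi fun _ => ν.prod ν)))
    rw [(hmp1 t).map_eq] at this
    exact this.symm
  have he2 : ∀ t : Fin n, ∫ p : Fin n → ℝ × ℝ, h (p t).2 ∂(Measure.pi fun _ => ν.prod ν) =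
      ∫ z, h z ∂ν := fun t => by
    have := integral_map (hmp2 t).measurable.aemeasurable
      (hhm.aestronglyMeasurable (μ := Measure.map _ (Measure.pi fun _ => ν.prod ν)))
    rw [(hmp2 t).map_eq] at this
    exact this.symm
  have hi12 : ∀ t : Fin n, Integrable (fun p : Fin n → ℝ × ℝ => h (p t).1 + h (p t).2)
      (Measure.pi fun _ => ν.prod ν) := fun t => (hi1 t).add (hi2 t)
  have hsum : Integrable (fun p : Fin n → ℝ × ℝ => ∑ t, (h (p t).1 + h (p t).2))
      (Measure.pi fun _ => ν.prod ν) := integrable_finsetSum _ fun t _ => hi12 t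
  have hpos : (2 : ℝ≥0∞) ^ n ≠ 0 := by simp
  have htop : (2 : ℝ≥0∞) ^ n ≠ ⊤ := ENNReal.pow_ne_top (by simp)
  rw [← ENNReal.mul_le_mul_iff_right hpos htop]
  refine (lintegral_weightedSupNorm_le_signs ν (continuous_logWeight δ) (logWeight_nonneg δ)
    (measurable_ecfKernel k) (continuous_ecfKernel k) hi n _).trans ?_
  refine (lintegral_mono fun p => hC δ hδ n hn p).trans ?_
  rw [lintegral_const_mul' _ _ htop]
  gcongr
  rw [← ofReal_integral_eq_lintegral_ofReal]
  · refine ENNReal.ofReal_le_ofReal (le_of_eq ?_)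
    rw [integral_const_mul, integral_add (integrable_const _) (hsum.const_mul _),
      integral_const_mul, integral_finsetSum _ fun t _ => hi12 t]
    simp_rw [fun t : Fin n => integral_add (hi1 t) (hi2 t), he1, he2]
    simp only [integral_const, probReal_univ, smul_eq_mul, Finset.sum_const, Finset.card_univ,
      Fintype.card_fin, nsmul_eq_mul, mul_one]
    field_simp
    ring
  · exact ((integrable_const _).add (hsum.const_mul _)).const_mul _
  · refine Filter.Eventually.of_forall fun p => ?_
    have : 0 ≤ ∑ t, (h (p t).1 + h (p t).2) :=
      Finset.sum_nonneg fun t _ => add_nonneg (hh0 _) (hh0 _)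
    positivity

/-! ### Differentiation of the process and conclusion -/

theorem contDiff_cexp_I_mul (z : ℝ) (k : ℕ) :
    ContDiff ℝ k fun u : ℝ => Complex.exp (Complex.I * (u : ℂ) * (z : ℂ)) := by
  have : ContDiff ℝ k fun u : ℝ => (u : ℂ) := Complex.ofRealCLM.contDiff
  exact ((contDiff_const.mul this).mul contDiff_const).cexp

theorem iteratedDeriv_cexp_I_mul (z : ℝ) (k : ℕ) :
    iteratedDeriv k (fun u : ℝ => Complex.exp (Complex.I * (u : ℂ) * (z : ℂ))) =
      ecfKernel k z := by
  induction k with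
  | zero => ext u; simp [ecfKernel]
  | succ k ih =>
    rw [iteratedDeriv_succ, ih]
    ext u
    have h1 : HasDerivAt (fun u : ℝ => Complex.I * (u : ℂ) * (z : ℂ)) (Complex.I * 1 * z) u :=
      ((Complex.ofRealCLM.hasDerivAt (x := u)).const_mul Complex.I).mul_const (z : ℂ)
    have h2 := (h1.cexp.const_mul ((Complex.I * (z : ℂ)) ^ k)).deriv
    refine h2.trans ?_
    rw [ecfKernel, pow_succ]
    ring

/-- Viewing the mean as a characteristic function reduces differentiation under the integral to the
moment condition `MemLp id k`. -/
theorem integral_cexp_eq_charFun {Ω : Type*} [MeasurableSpace Ω] {μ : Measure Ω} {X : Ω → ℝ}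
    (hX : Measurable X) (u : ℝ) :
    ∫ ω, Complex.exp (Complex.I * (u : ℂ) * (X ω : ℂ)) ∂μ = charFun (μ.map X) u := by
  rw [charFun_apply_real, integral_map hX.aemeasurable (by fun_prop)]
  refine integral_congr_ae (Filter.Eventually.of_forall fun ω => ?_)
  simp only
  ring_nf

theorem iteratedDeriv_charFun_eq_integral_ecfKernel {ν : Measure ℝ} [IsFiniteMeasure ν] {k : ℕ}
    (h : MemLp id k ν) (u : ℝ) :
    iteratedDeriv k (charFun ν) u = ∫ z, ecfKernel k z u ∂ν := by
  rw [iteratedDeriv_charFun h, ← integral_const_mul]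
  refine integral_congr_ae (Filter.Eventually.of_forall fun z => ?_)
  simp only [ecfKernel, mul_pow]
  ring_nf

theorem integrable_abs_pow_of_integrable_rpow {ν : Measure ℝ} [IsFiniteMeasure ν] {k : ℕ} {γ : ℝ}
    (hγ : 0 < γ) (h : Integrable (fun z => |z| ^ (2 * (k : ℝ) + γ)) ν) :
    Integrable (fun z => |z| ^ k) ν := by
  refine ((integrable_const 1).add h).mono' (by fun_prop) (Filter.Eventually.of_forall fun z => ?_)
  rw [Real.norm_of_nonneg (by positivity), ← Real.rpow_natCast]
  exact rpow_le_one_add_rpow (abs_nonneg z) (by positivity) (by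
    have : (0 : ℝ) ≤ k := by positivity
    linarith)

theorem memLp_id_of_integrable_abs_pow {ν : Measure ℝ} [IsFiniteMeasure ν] {k : ℕ}
    (h : Integrable (fun z => |z| ^ k) ν) : MemLp id k ν := by
  -- At exponent `0`, `MemLp` is mere measurability, and `integrable_norm_rpow_iff` needs a nonzero
  -- exponent.
  rcases Nat.eq_zero_or_pos k with rfl | hk
  · simpa using by fun_prop
  · refine (integrable_norm_rpow_iff (by fun_prop) (by exact_mod_cast hk.ne') (by simp)).1 ?_
    simpa using h

theorem ecfProcess_eq {Ω : Type*} [MeasurableSpace Ω] {μ : Measure Ω} {Z : ℕ → Ω → ℝ}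
    (hmeas : Measurable (Z 0)) (n : ℕ) (ω : Ω) :
    ecfProcess μ Z n ω = fun u : ℝ => (((n : ℝ) ^ (-(1 / 2) : ℝ) : ℝ) : ℂ) *
      ∑ t : Fin n, (Complex.exp (Complex.I * (u : ℂ) * (Z t ω : ℂ)) -
        charFun (μ.map (Z 0)) u) := by
  ext u
  rw [ecfProcess, integral_cexp_eq_charFun hmeas, Finset.sum_range]

theorem contDiff_ecfProcess {Ω : Type*} [MeasurableSpace Ω] {μ : Measure Ω} [IsFiniteMeasure μ]
    {Z : ℕ → Ω → ℝ} (hmeas : Measurable (Z 0)) {k : ℕ} (h : MemLp id k (μ.map (Z 0)))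
    (n : ℕ) (ω : Ω) : ContDiff ℝ k (ecfProcess μ Z n ω) := by
  rw [ecfProcess_eq hmeas]
  exact contDiff_const.mul (ContDiff.sum fun t _ => (contDiff_cexp_I_mul _ k).sub
    (contDiff_charFun h))

theorem iteratedDeriv_ecfProcess {Ω : Type*} [MeasurableSpace Ω] {μ : Measure Ω}
    [IsFiniteMeasure μ] {Z : ℕ → Ω → ℝ} (hmeas : Measurable (Z 0)) {k : ℕ}
    (h : MemLp id k (μ.map (Z 0))) (n : ℕ) (ω : Ω) :
    iteratedDeriv k (ecfProcess μ Z n ω) = fun u => (((n : ℝ) ^ (-(1 / 2) : ℝ) : ℝ) : ℂ) *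
      ∑ t : Fin n, (ecfKernel k (Z t ω) u - ∫ z, ecfKernel k z u ∂(μ.map (Z 0))) := by
  rw [ecfProcess_eq hmeas]
  ext u
  rw [iteratedDeriv_const_mul_field, iteratedDeriv_fun_sum fun t _ =>
    ((contDiff_cexp_I_mul _ k).sub (contDiff_charFun h)).contDiffAt]
  congr 1
  refine Finset.sum_congr rfl fun t _ => ?_
  rw [iteratedDeriv_fun_sub (contDiff_cexp_I_mul _ k).contDiffAt (contDiff_charFun h).contDiffAt,
    iteratedDeriv_cexp_I_mul, iteratedDeriv_charFun_eq_integral_ecfKernel h]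

theorem theorem4p1 {Ω : Type*} [MeasurableSpace Ω] (μ : Measure Ω) [IsProbabilityMeasure μ]
    (Z : ℕ → Ω → ℝ) (hmeas : ∀ t, Measurable (Z t)) (hindep : iIndepFun Z μ)
    (hident : ∀ t, IdentDistrib (Z t) (Z 0) μ μ)
    (k : ℕ) (γ : ℝ) (hγ : 0 < γ)
    (hmoment : Integrable (fun ω => |Z 0 ω| ^ (2 * (k : ℝ) + γ)) μ)
    (δ : ℝ) (hδ : 0 < δ) :
    -- the `k`-th derivative exists (and is continuous), for every sample point
    (∀ n : ℕ, 1 ≤ n → ∀ ω, ContDiff ℝ k (ecfProcess μ Z n ω)) ∧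
    -- the weighted supremum is a random variable, so that its expectation makes sense
    (∀ n : ℕ, 1 ≤ n → Measurable fun ω =>
      weightedSupNorm (logWeight δ) (iteratedDeriv k (ecfProcess μ Z n ω))) ∧
    (⨆ n : ℕ, ⨆ _ : 1 ≤ n,
      ∫⁻ ω, weightedSupNorm (logWeight δ) (iteratedDeriv k (ecfProcess μ Z n ω)) ∂μ) < ⊤ := by
  set ν := μ.map (Z 0) with hν
  have : IsProbabilityMeasure ν := Measure.isProbabilityMeasure_map (hmeas 0).aemeasurable
  have hmom : Integrable (fun z => |z| ^ (2 * (k : ℝ) + γ)) ν :=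
    (integrable_map_measure
      (by fun_prop : Measurable fun z : ℝ => |z| ^ (2 * (k : ℝ) + γ)).aestronglyMeasurable (hmeas 0).aemeasurable).2 hmoment
  have habs := integrable_abs_pow_of_integrable_rpow hγ hmom
  have hLp : MemLp id k ν := memLp_id_of_integrable_abs_pow habs
  have hi : ∀ u, Integrable (fun z => ecfKernel k z u) ν := fun u =>
    habs.mono' (measurable_ecfKernel k u).aestronglyMeasurable
      (Filter.Eventually.of_forall fun z => (norm_ecfKernel k z u).le)
  have hcd := contDiff_ecfProcess (μ := μ) (hmeas 0) hLp
  have hmean : Continuous fun u => ∫ z, ecfKernel k z u ∂ν := by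
    simp_rw [← iteratedDeriv_charFun_eq_integral_ecfKernel hLp]
    exact (contDiff_charFun hLp).continuous_iteratedDeriv k le_rfl
  have hmeasurable : ∀ n : ℕ, Measurable fun z : Fin n → ℝ => weightedSupNorm (logWeight δ)
      (fun u => (((n : ℝ) ^ (-(1 / 2) : ℝ) : ℝ) : ℂ) *
        ∑ t : Fin n, (ecfKernel k (z t) u - ∫ z, ecfKernel k z u ∂ν)) := fun n => by
    refine measurable_weightedSupNorm (continuous_logWeight δ) (fun u => ?_) fun z => ?_
    · exact measurable_const.mul (Finset.measurable_sum _ fun t _ =>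
        ((measurable_ecfKernel k u).comp (measurable_pi_apply t)).sub measurable_const)
    · exact continuous_const.mul (continuous_finsetSum _ fun t _ =>
        (continuous_ecfKernel k _).sub hmean)
  have hsample : ∀ n : ℕ, Measurable fun ω (t : Fin n) => Z t ω := fun n =>
    measurable_pi_lambda _ fun t => hmeas t
  refine ⟨fun n _ ω => hcd n ω, fun n _ => ?_, ?_⟩
  · simp_rw [iteratedDeriv_ecfProcess (hmeas 0) hLp]
    exact (hmeasurable n).comp (hsample n)
  · obtain ⟨M, hM, hbound⟩ := exists_lintegral_weightedSupNorm_ecfKernel_le ν k hγ hmom hi hδ.le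
    refine lt_of_le_of_lt (iSup₂_le fun n hn => ?_) hM
    -- Independence and identical distribution enter only here: the sample has the product law.
    have hlaw : μ.map (fun ω (t : Fin n) => Z t ω) = Measure.pi fun _ => ν := by
      rw [(iIndepFun_iff_map_fun_eq_pi_map fun t : Fin n => (hmeas t).aemeasurable).1
        (hindep.precomp (g := fun t : Fin n => (t : ℕ)) Fin.val_injective)]
      congr 1
      ext1 t
      exact (hident t).map_eq
    refine le_trans (le_of_eq ?_) (hbound n hn)
    rw [← hlaw, lintegral_map (hmeasurable n) (hsample n)]
    simp_rw [iteratedDeriv_ecfProcess (hmeas 0) hLp]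
    rfl
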